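/- All graphs here are finite and may have loops. A colouring $c:V(G)\to\{1,\dots,k\}$ of the vertices of a graph $G$ is called edge-distinguishing if the labels $\{c(u),c(v)\}$ of the edges $uv\in E(G)$ (with $\{c(u),c(u)\}=\{c(u)\}$) are pairwise distinct. The edge-distinguishing chromatic number $\lambda(G)$ of $G$ is the minimum positive integer $k$ for which such a colouring exists. For integers $c_2,c_3\ge 3$, let $P_{1,c_2,c_3}$ be the graph with vertices $u_0$, $u^2_1,\dots,u^2_{c_2-1}$, $u^3_1,\dots,u^3_{c_3-1}$ whose edges are a loop at $u_0$ and the edges of the two cycles $u_0u^i_1u^i_2\cdots u^i_{c_i-1}u_0$ of length $c_i$, $i=2,3$. **Theorem.** Let $c_2,c_3$ be integers with $3\le c_2\le c_3$, and let $e=1+c_2+c_3$ be the number of edges of $P_{1,c_2,c_3}$. Then $$\lambda(P_{1,c_2,c_3})=\begin{cases}5&\text{if } e\le 10,\\[2pt] \left\lceil\frac{-1+\sqrt{8e+1}}{2}\right\rceil&\text{if } e\ge 11\text{ and }\left\lceil\frac{-1+\sqrt{8e+1}}{2}\right\rceil\text{ is odd},\\[4pt] \left\lceil\sqrt{2e}\,\right\rceil&\text{if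 } e\ge 11\text{ and }\left\lceil\frac{-1+\sqrt{8e+1}}{2}\right\rceil\text{ is even}.\end{cases}$$ -/

import Mathlib

/-- A colouring `c` of the vertices of a graph `G` (loops allowed) is edge-distinguishing if the
induced edge colouring `e = uv ↦ {c u, c v}` is injective on the edges of `G`.
Only the values of `c` on vertices of `G` matter. -/
def IsEdgeDistinguishing {α β κ : Type*} (G : Graph α β) (c : α → κ) : Prop :=
  ∀ ⦃e f : β⦄ ⦃u v x y : α⦄, G.IsLink e u v → G.IsLink f x y →
    s(c u, c v) = s(c x, c y) → e = f

/-- The edge-distinguishing chromatic number: the minimum positive integer `k` such that `G` has an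
edge-distinguishing vertex colouring with the `k` colours `Fin k`.
(The value is `0` if there is no such `k`, and only then.) -/
noncomputable def edcn {α β : Type*} (G : Graph α β) : ℕ :=
  sInf {k : ℕ | 0 < k ∧ ∃ c : α → Fin k, IsEdgeDistinguishing G c}

/-- The `j`-th vertex, `0 ≤ j ≤ c i`, in the cyclic order along the `i`-th petal of a petal graph:
`none` is the common vertex `u₀`, which is both the start (`j = 0`) and the end (`j = c i`) of each
petal, and `some (i, j)` is the vertex `uⁱⱼ`, for `1 ≤ j ≤ c i - 1`. -/
def petalVertex {m : ℕ} (c : Fin m → ℕ) (i : Fin m) (j : ℕ) : Option (Fin m × ℕ) :=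
  if j = 0 ∨ j = c i then none else some (i, j)

/-- The petal graph with `m` petals, which are cycles of lengths `c 0, …, c (m - 1)` sharing the
vertex `u₀ = none` and nothing else; a petal of length one is a loop at `u₀`.
The edge `(i, j)`, `0 ≤ j < c i`, joins the `j`-th and the `(j + 1)`-th vertex of the petal `i`. -/
def petalGraph {m : ℕ} (c : Fin m → ℕ) : Graph (Option (Fin m × ℕ)) (Fin m × ℕ) where
  vertexSet := {u | u = none ∨ ∃ i j, 1 ≤ j ∧ j < c i ∧ u = some (i, j)}
  edgeSet := {e | e.2 < c e.1}
  IsLink e x y := e.2 < c e.1 ∧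
    s(x, y) = s(petalVertex c e.1 e.2, petalVertex c e.1 (e.2 + 1))
  isLink_symm := fun _ _ => ⟨fun _ _ h => ⟨h.1, Sym2.eq_swap.trans h.2⟩⟩
  eq_or_eq_of_isLink_of_isLink := by
    rintro e x y v w ⟨-, h₁⟩ ⟨-, h₂⟩
    have h := h₁.trans h₂.symm
    rw [Sym2.eq_iff] at h
    tauto
  edge_mem_iff_exists_isLink := fun _ => ⟨fun h => ⟨_, _, h, rfl⟩, fun ⟨_, _, h, _⟩ => h⟩
  left_mem_of_isLink := by
    rintro ⟨i, j⟩ x y ⟨h, hs⟩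
    rw [Sym2.eq_iff] at hs
    simp only at h hs
    have key : ∀ l, l ≤ c i → petalVertex c i l ∈
        {u : Option (Fin m × ℕ) | u = none ∨ ∃ i j, 1 ≤ j ∧ j < c i ∧ u = some (i, j)} := by
      intro l hl
      by_cases hl' : l = 0 ∨ l = c i
      · exact Or.inl (if_pos hl')
      · exact Or.inr ⟨i, l, by omega, by omega, if_neg hl'⟩
    rcases hs with ⟨rfl, -⟩ | ⟨rfl, -⟩
    · exact key j (by omega)
    · exact key (j + 1) (by omega)

/-! A colouring with `k` colours is the same as an edge-injective image of the graph in the complete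
graph with loops on `k` vertices: the loop at 0 and two edge-disjoint closed trails through 0, of
lengths `c₂` and `c₃`. Such an image exists iff `5 ≤ k`, `2e ≤ k(k+1)` and, for even `k`, `2e ≤ k²`
(`exists_isEdgeDistinguishing_petalGraph_iff`); the rest is arithmetic with ceilings.

Necessity: the five edges at `u₀` force five colours, and there are `k(k+1)/2` labels. The image has
even degree at every colour, so for even `k` at most `k - 2` of the `k - 1` non-loop labels at each
colour occur, leaving at most `k(k-2)/2 + k = k²/2` labels.

Sufficiency (`hasTwoTrails`): induction from `k` to `k + 2`. The bound on `e` grows by `2k + 3` for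
odd `k` and by `2k + 2` for even `k`. A closed trail of any length from 3 up to this, using only
edges at the two new vertices, can be appended at 0 to an old trail. Explicit trails settle `k = 5,
6` and the few pairs of lengths for `k = 7, 8` that the induction misses. -/

/-! ### Closed trails as vertex lists -/

/-- The edges of the closed walk which starts at `a`, visits the vertices of the list in order, and
then goes to `0`. -/
def closingEdges : ℕ → List ℕ → List (Sym2 ℕ)
  | a, [] => [s(a, 0)]
  | a, b :: l => s(a, b) :: closingEdges b l

theorem closingEdges_append (a : ℕ) (l m : List ℕ) :
    closingEdges a (l ++ 0 :: m) = closingEdges a l ++ closingEdges 0 m := by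
  induction l generalizing a with
  | nil => rfl
  | cons b l ih => simp [closingEdges, ih]

theorem length_closingEdges (a : ℕ) (l : List ℕ) : (closingEdges a l).length = l.length + 1 := by
  induction l generalizing a with
  | nil => rfl
  | cons b l ih => simp [closingEdges, ih]

/-- The default value 0 of `getD` supplies the final return to 0. -/
theorem getElem_closingEdges (a : ℕ) (l : List ℕ) (j : ℕ) (hj : j < (closingEdges a l).length) :
    (closingEdges a l)[j] = s((a :: l).getD j 0, (a :: l).getD (j + 1) 0) := by
  induction l generalizing a j with
  | nil =>
    obtain rfl : j = 0 := by simpa [closingEdges] using hj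
    rfl
  | cons b l ih =>
    cases j with
    | zero => rfl
    | succ j => exact ih b j (by simpa [closingEdges] using hj)

theorem lt_of_mem_closingEdges {k a : ℕ} {l : List ℕ} (hk : 0 < k) (ha : a < k)
    (hl : ∀ v ∈ l, v < k) : ∀ e ∈ closingEdges a l, ∀ v ∈ e, v < k := by
  induction l generalizing a with
  | nil => simp [closingEdges, hk, ha]
  | cons b l ih =>
    simp only [List.mem_cons, forall_eq_or_imp] at hl
    simpa [closingEdges, ha, hl.1] using ih hl.1 hl.2

/-- The complete graph with loops on the vertices `0, …, k - 1` contains two closed trails through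
`0`, of lengths `a` and `b`, which share no edge and do not use the loop at `0`. -/
def HasTwoTrails (k a b : ℕ) : Prop :=
  ∃ l m : List ℕ, l.length + 1 = a ∧ m.length + 1 = b ∧ (∀ v ∈ l, v < k) ∧ (∀ v ∈ m, v < k) ∧
    (s(0, 0) :: (closingEdges 0 l ++ closingEdges 0 m)).Nodup

theorem HasTwoTrails.symm {k a b : ℕ} (h : HasTwoTrails k a b) : HasTwoTrails k b a := by
  obtain ⟨l, m, hl, hm, hlk, hmk, h⟩ := h
  exact ⟨m, l, hm, hl, hmk, hlk, h.perm (List.perm_append_comm.cons _)⟩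

theorem HasTwoTrails.mono {k n a b : ℕ} (h : HasTwoTrails k a b) (hkn : k ≤ n) :
    HasTwoTrails n a b := by
  obtain ⟨l, m, hl, hm, hlk, hmk, h⟩ := h
  exact ⟨l, m, hl, hm, fun v hv => (hlk v hv).trans_le hkn, fun v hv => (hmk v hv).trans_le hkn, h⟩

/-! ### Extension by two new vertices -/

/-- There is a closed trail of length `t` through `0` which begins with the edge from `0` to `k`, all
of whose edges are incident to `k` or `k + 1`, and whose other vertices are less than `m`. -/
def HasNewTrail (k t m : ℕ) : Prop :=
  ∃ l : List ℕ, l.length + 2 = t ∧ (∀ v ∈ l, v < m ∨ v = k ∨ v = k + 1) ∧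
    (closingEdges 0 (k :: l)).Nodup ∧
    ∀ e ∈ closingEdges 0 (k :: l), (k ∈ e ∨ k + 1 ∈ e) ∧ ∀ v ∈ e, v < m ∨ k ≤ v

/-- The old vertices `m` and `m + 1` are still unused, so the 4-cycle `k, m, k + 1, m + 1, k` can be
spliced in at the first visit to `k`. -/
theorem HasNewTrail.add_four {k t m : ℕ} (h : HasNewTrail k t m) (hm : 0 < m) (hmk : m + 2 ≤ k) :
    HasNewTrail k (t + 4) (m + 2) := by
  obtain ⟨l, hl, hlv, hnd, he⟩ := h
  have key : ∀ i, m ≤ i → i < k → ∀ v, s(i, v) ∉ closingEdges 0 (k :: l) := by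
    intro i hi hik v hv
    have := (he _ hv).2 i (by simp)
    omega
  have key' : ∀ i, m ≤ i → i < k → ∀ v, s(v, i) ∉ closingEdges 0 (k :: l) := by
    intro i hi hik v hv
    exact key i hi hik v (Sym2.eq_swap ▸ hv)
  refine ⟨m :: (k + 1) :: (m + 1) :: k :: l, by simp [← hl], ?_, ?_, ?_⟩
  · simp only [List.mem_cons, forall_eq_or_imp]
    refine ⟨by simp, by simp, by simp, by simp, fun v hv => ?_⟩
    have := hlv v hv
    omega
  · have h1 := key m le_rfl (by omega)
    have h2 := key (m + 1) (by omega) (by omega)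
    have h1' := key' m le_rfl (by omega)
    have h2' := key' (m + 1) (by omega) (by omega)
    simp only [closingEdges, List.mem_cons, not_or] at h1 h2 h1' h2'
    simp only [closingEdges, List.nodup_cons, List.mem_cons, not_or] at hnd ⊢
    refine ⟨⟨?_, ?_, ?_, ?_, hnd.1⟩, ⟨?_, ?_, ?_, (h1' k).2⟩, ⟨?_, ?_, (h1 _).2⟩,
      ⟨?_, (h2' _).2⟩, (h2 _).2, hnd.2⟩ <;> simp only [Sym2.eq_iff] <;> omega
  · simp only [closingEdges, List.mem_cons, forall_eq_or_imp, Sym2.mem_iff] at he ⊢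
    have aux : ∀ v, v < m ∨ k ≤ v → v < m + 2 ∨ k ≤ v := by omega
    refine ⟨?_, ?_, ?_, ?_, ?_, fun e h => ⟨(he.2 e h).1, fun v hv => aux v ((he.2 e h).2 v hv)⟩⟩
    all_goals
      refine ⟨by simp, ?_⟩
      simp only [forall_eq]
      omega

/-- Seeds of lengths 3, 4, 5, 6 cover the residues mod 4. The first three are a triangle with 0, 1
or 2 loops and touch only the old vertex 0; length 6 also needs the old vertex 1. Each 4-cycle
spliced in consumes two more old vertices. -/
theorem hasNewTrail_of_le {k t : ℕ} (hk : 2 ≤ k) (ht : 3 ≤ t)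
    (htk : t ≤ 2 * k + 2 ∨ Odd k ∧ t = 2 * k + 3) : HasNewTrail k t k := by
  have mono : ∀ {m}, m ≤ k → HasNewTrail k t m → HasNewTrail k t k := by
    rintro m hm ⟨l, hl, hlv, hnd, he⟩
    refine ⟨l, hl, fun v hv => ?_, hnd, fun e h => ⟨(he e h).1, fun v hv => ?_⟩⟩
    · have := hlv v hv
      omega
    · have := (he e h).2 v hv
      omega
  have iter : ∀ {s m}, HasNewTrail k s m → 0 < m → ∀ j, m + 2 * j ≤ k →
      HasNewTrail k (s + 4 * j) (m + 2 * j) := by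
    intro s m h hm j
    induction j with
    | zero => exact fun _ => h
    | succ j ih =>
      intro hj
      exact (ih (by omega)).add_four (by omega) (by omega)
  have h3 : HasNewTrail k 3 1 := by
    refine ⟨[k + 1], rfl, by simp, ?_, ?_⟩
    · simp [closingEdges]; omega
    · simp [closingEdges]
  have h4 : HasNewTrail k 4 1 := by
    refine ⟨[k, k + 1], rfl, by simp, ?_, ?_⟩
    · simp [closingEdges]; omega
    · simp [closingEdges]
  have h5 : HasNewTrail k 5 1 := by
    refine ⟨[k, k + 1, k + 1], rfl, by simp, ?_, ?_⟩
    · simp [closingEdges]; omega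
    · simp [closingEdges]
  have h6 : HasNewTrail k 6 2 := by
    refine ⟨[k, 1, k + 1, k + 1], rfl, by simp, ?_, ?_⟩
    · simp [closingEdges]; omega
    · simp [closingEdges]
  have hodd : ∀ {n}, Odd n → n % 2 = 1 := Nat.odd_iff.mp
  obtain ⟨j, hj⟩ : ∃ j, t = 3 + 4 * j ∨ t = 4 + 4 * j ∨ t = 5 + 4 * j ∨ t = 6 + 4 * j :=
    ⟨(t - 3) / 4, by omega⟩
  have hb : t ≤ 2 * k + 2 ∨ k % 2 = 1 ∧ t = 2 * k + 3 := htk.imp_right (And.imp_left hodd)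
  rcases hj with rfl | rfl | rfl | rfl
  · exact mono (by omega) (iter h3 one_pos j (by omega))
  · exact mono (by omega) (iter h4 one_pos j (by omega))
  · exact mono (by omega) (iter h5 one_pos j (by omega))
  · exact mono (by omega) (iter h6 two_pos j (by omega))

theorem HasTwoTrails.add_new {k a b t : ℕ} (h : HasTwoTrails k a b) (hk : 2 ≤ k)
    (ht : HasNewTrail k t k) : HasTwoTrails (k + 2) a (b + t) := by
  obtain ⟨l, m, rfl, rfl, hlk, hmk, h⟩ := h
  obtain ⟨n, rfl, hnv, hnd, he⟩ := ht
  refine ⟨l, m ++ 0 :: k :: n, rfl, by simp; omega, fun v hv => (hlk v hv).trans (by omega), ?_, ?_⟩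
  · intro v hv
    simp only [List.mem_append, List.mem_cons] at hv
    rcases hv with hv | rfl | rfl | hv
    · have := hmk v hv
      omega
    · omega
    · omega
    · have := hnv v hv
      omega
  · rw [closingEdges_append, ← List.append_assoc, ← List.cons_append]
    refine h.append hnd ?_
    intro e h1 h2
    have hlt : ∀ v ∈ e, v < k := by
      simp only [List.mem_cons, List.mem_append] at h1
      rcases h1 with rfl | h1 | h1
      · simp; omega
      · exact lt_of_mem_closingEdges (by omega) (by omega) hlk e h1
      · exact lt_of_mem_closingEdges (by omega) (by omega) hmk e h1
    rcases (he e h2).1 with h | h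
    · exact (hlt _ h).false
    · have := hlt _ h
      omega

/-! ### Explicit trails for five to eight colours -/

theorem hasTwoTrails_of_decide {k a b : ℕ} (l m : List ℕ)
    (h : l.length + 1 = a ∧ m.length + 1 = b ∧ (∀ v ∈ l, v < k) ∧ (∀ v ∈ m, v < k) ∧
      (s(0, 0) :: (closingEdges 0 l ++ closingEdges 0 m)).Nodup) : HasTwoTrails k a b :=
  ⟨l, m, h⟩

theorem hasTwoTrails_five {a b : ℕ} (ha : 3 ≤ a) (hab : a ≤ b) (h : a + b ≤ 14) :
    HasTwoTrails 5 a b := by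
  have : a ≤ 7 := by omega
  have : b ≤ 11 := by omega
  interval_cases a <;> interval_cases b <;> first | omega | skip
  · exact hasTwoTrails_of_decide [2, 1] [4, 3] (by decide)
  · exact hasTwoTrails_of_decide [2, 1] [4, 1, 3] (by decide)
  · exact hasTwoTrails_of_decide [2, 1] [4, 1, 1, 3] (by decide)
  · exact hasTwoTrails_of_decide [2, 1] [4, 1, 1, 3, 3] (by decide)
  · exact hasTwoTrails_of_decide [2, 1] [4, 1, 3, 2, 4, 3] (by decide)
  · exact hasTwoTrails_of_decide [2, 1] [4, 1, 1, 3, 2, 4, 3] (by decide)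
  · exact hasTwoTrails_of_decide [2, 1] [4, 1, 1, 3, 2, 2, 4, 3] (by decide)
  · exact hasTwoTrails_of_decide [2, 1] [4, 1, 1, 3, 2, 2, 4, 3, 3] (by decide)
  · exact hasTwoTrails_of_decide [2, 1] [4, 1, 1, 3, 2, 2, 4, 4, 3, 3] (by decide)
  · exact hasTwoTrails_of_decide [2, 2, 1] [4, 1, 3] (by decide)
  · exact hasTwoTrails_of_decide [2, 2, 1] [4, 1, 1, 3] (by decide)
  · exact hasTwoTrails_of_decide [2, 2, 1] [4, 1, 1, 3, 3] (by decide)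
  · exact hasTwoTrails_of_decide [2, 2, 1] [4, 1, 3, 4, 2, 3] (by decide)
  · exact hasTwoTrails_of_decide [2, 2, 1] [4, 1, 1, 3, 2, 4, 3] (by decide)
  · exact hasTwoTrails_of_decide [2, 2, 1] [4, 1, 1, 3, 2, 4, 4, 3] (by decide)
  · exact hasTwoTrails_of_decide [2, 2, 1] [4, 1, 1, 3, 2, 4, 4, 3, 3] (by decide)
  · exact hasTwoTrails_of_decide [2, 2, 1, 3] [1, 1, 4, 4] (by decide)
  · exact hasTwoTrails_of_decide [2, 2, 1, 3] [1, 4, 2, 3, 4] (by decide)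
  · exact hasTwoTrails_of_decide [2, 2, 1, 3] [1, 4, 2, 3, 4, 4] (by decide)
  · exact hasTwoTrails_of_decide [2, 2, 1, 3] [1, 4, 2, 3, 3, 4, 4] (by decide)
  · exact hasTwoTrails_of_decide [2, 2, 1, 3] [1, 1, 4, 2, 3, 3, 4, 4] (by decide)
  · exact hasTwoTrails_of_decide [2, 2, 1, 3, 4] [1, 4, 4, 2, 3] (by decide)
  · exact hasTwoTrails_of_decide [2, 2, 1, 3, 4] [1, 4, 4, 2, 3, 3] (by decide)
  · exact hasTwoTrails_of_decide [2, 2, 1, 3, 4] [1, 1, 4, 4, 2, 3, 3] (by decide)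
  · exact hasTwoTrails_of_decide [2, 2, 1, 3, 2, 4] [3, 3, 4, 4, 1, 1] (by decide)

theorem hasTwoTrails_six {a b : ℕ} (ha : 3 ≤ a) (hab : a ≤ b) (h : a + b ≤ 17) :
    HasTwoTrails 6 a b := by
  by_cases h' : a + b ≤ 14
  · exact (hasTwoTrails_five ha hab h').mono (by omega)
  have : a ≤ 8 := by omega
  have : b ≤ 14 := by omega
  interval_cases a <;> interval_cases b <;> first | omega | skip
  · exact hasTwoTrails_of_decide [4, 1] [3, 1, 1, 2, 2, 4, 4, 5, 3, 3, 2] (by decide)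
  · exact hasTwoTrails_of_decide [4, 1] [3, 1, 1, 2, 2, 4, 4, 5, 3, 3, 2, 5] (by decide)
  · exact hasTwoTrails_of_decide [4, 1] [3, 1, 1, 2, 2, 4, 4, 5, 3, 3, 2, 5, 5] (by decide)
  · exact hasTwoTrails_of_decide [4, 4, 5] [3, 1, 1, 5, 5, 2, 2, 1, 4, 2] (by decide)
  · exact hasTwoTrails_of_decide [4, 4, 5] [3, 1, 1, 5, 2, 1, 4, 3, 3, 2, 2] (by decide)
  · exact hasTwoTrails_of_decide [4, 4, 5] [3, 1, 1, 5, 5, 3, 3, 2, 2, 4, 1, 2] (by decide)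
  · exact hasTwoTrails_of_decide [4, 4, 5, 5] [1, 1, 2, 2, 4, 3, 5, 1, 3] (by decide)
  · exact hasTwoTrails_of_decide [4, 4, 5, 5] [1, 1, 2, 2, 4, 3, 5, 1, 3, 2] (by decide)
  · exact hasTwoTrails_of_decide [4, 4, 5, 5] [1, 1, 2, 2, 4, 3, 5, 1, 3, 3, 2] (by decide)
  · exact hasTwoTrails_of_decide [4, 4, 5, 5, 3] [1, 2, 2, 4, 3, 1, 1, 5] (by decide)
  · exact hasTwoTrails_of_decide [4, 4, 5, 5, 3] [1, 2, 2, 4, 3, 1, 1, 5, 2] (by decide)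
  · exact hasTwoTrails_of_decide [4, 4, 5, 5, 3] [1, 2, 2, 4, 3, 3, 1, 1, 5, 2] (by decide)
  · exact hasTwoTrails_of_decide [4, 4, 5, 5, 3, 1] [2, 2, 1, 4, 3, 2, 5] (by decide)
  · exact hasTwoTrails_of_decide [4, 4, 5, 5, 3, 1] [2, 2, 1, 4, 3, 3, 2, 5] (by decide)
  · exact hasTwoTrails_of_decide [4, 4, 5, 5, 3, 1] [2, 2, 1, 1, 5, 2, 4, 3, 3] (by decide)
  · exact hasTwoTrails_of_decide [4, 4, 5, 5, 3, 1, 1] [3, 4, 2, 5, 1, 2, 2] (by decide)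
  · exact hasTwoTrails_of_decide [4, 4, 5, 5, 3, 1, 1] [3, 3, 2, 4, 1, 5, 2, 2] (by decide)

theorem hasTwoTrails_seven {a b : ℕ} (ha : 12 ≤ a) (hab : a ≤ b) (h : a + b ≤ 27) :
    HasTwoTrails 7 a b := by
  have : a ≤ 13 := by omega
  have : b ≤ 15 := by omega
  interval_cases a <;> interval_cases b <;> first | omega | skip
  · exact hasTwoTrails_of_decide [4, 1, 6, 2, 1, 0, 6, 4, 4, 2, 5] [3, 6, 5, 3, 1, 5, 4, 3, 3, 2, 2] (by decide)
  · exact hasTwoTrails_of_decide [4, 1, 6, 2, 1, 0, 6, 4, 4, 2, 5] [3, 6, 5, 3, 1, 5, 5, 4, 3, 3, 2, 2] (by decide)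
  · exact hasTwoTrails_of_decide [4, 1, 6, 2, 1, 0, 6, 4, 4, 2, 5] [3, 6, 5, 3, 1, 1, 5, 5, 4, 3, 3, 2, 2] (by decide)
  · exact hasTwoTrails_of_decide [4, 1, 6, 2, 1, 0, 6, 4, 4, 2, 5] [3, 6, 6, 5, 4, 3, 3, 5, 5, 1, 1, 3, 2, 2] (by decide)
  · exact hasTwoTrails_of_decide [4, 1, 6, 2, 1, 0, 6, 4, 4, 2, 5, 3] [2, 2, 3, 4, 5, 6, 6, 3, 3, 1, 1, 5] (by decide)
  · exact hasTwoTrails_of_decide [4, 1, 6, 2, 1, 0, 6, 4, 4, 2, 5, 3] [2, 2, 3, 4, 5, 6, 6, 3, 3, 1, 1, 5, 5] (by decide)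

theorem hasTwoTrails_eight {a b : ℕ} (ha : 15 ≤ a) (hab : a ≤ b) (h : a + b ≤ 31) :
    HasTwoTrails 8 a b := by
  obtain rfl : a = 15 := by omega
  have : b ≤ 16 := by omega
  interval_cases b
  · exact hasTwoTrails_of_decide [4, 1, 5, 3, 0, 1, 2, 3, 4, 6, 2, 7, 3, 6] [7, 4, 4, 2, 2, 5, 6, 6, 1, 1, 7, 7, 5, 5] (by decide)
  · exact hasTwoTrails_of_decide [5, 4, 6, 5, 5, 7, 1, 2, 6, 1, 3, 7, 4, 4] [1, 1, 5, 2, 0, 3, 2, 2, 4, 3, 3, 6, 6, 7, 7] (by decide)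

/-! ### Induction on the number of colours -/

theorem hasTwoTrails_add_two {k M a b : ℕ} (hk : 2 ≤ k)
    (ih : ∀ {a b}, 3 ≤ a → 3 ≤ b → 1 + a + b ≤ M → HasTwoTrails k a b)
    (ha : 3 ≤ a) (hb : 6 ≤ b) (haM : a + 4 ≤ M)
    (h : 1 + a + b ≤ M + (2 * k + 2) ∨ Odd k ∧ 1 + a + b ≤ M + (2 * k + 3)) :
    HasTwoTrails (k + 2) a b := by
  -- The least admissible length for the new trail that brings the remaining edges down to `M`. The
  -- two bounds `6 ≤ b` and `a + 4 ≤ M` leave `b - t ≥ 3` in the two cases of the maximum.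
  obtain ⟨t, ht⟩ : ∃ t, t = max 3 (1 + a + b - M) := ⟨_, rfl⟩
  have h1 := (ih ha (b := b - t) (by omega) (by omega)).add_new hk (t := t)
    (hasNewTrail_of_le hk (by omega) (by
      rcases h with h | ⟨ho, h⟩
      · omega
      · have := Nat.odd_iff.mp ho
        by_cases ht' : t = 2 * k + 3
        · exact Or.inr ⟨ho, ht'⟩
        · omega))
  rwa [Nat.sub_add_cancel (by omega)] at h1

theorem hasTwoTrails_odd (n : ℕ) {a b : ℕ} (ha : 3 ≤ a) (hb : 3 ≤ b)
    (h : 1 + a + b ≤ (n + 3) * (2 * n + 5)) : HasTwoTrails (2 * n + 5) a b := by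
  induction n generalizing a b with
  | zero =>
    rcases le_total a b with hab | hab
    · exact hasTwoTrails_five ha hab (by omega)
    · exact (hasTwoTrails_five hb hab (by omega)).symm
  | succ n ih =>
    wlog hab : a ≤ b generalizing a b
    · exact (this hb ha (by omega) (by omega)).symm
    by_cases h' : 1 + a + b ≤ (n + 3) * (2 * n + 5)
    · exact (ih ha hb h').mono (by omega)
    -- If `a ≥ 12`, at most 2 of the 15 edges for five colours remain beside the loop at 0 and the
    -- trail of length `a`, too few for a second trail.
    by_cases hn : n = 0 ∧ 12 ≤ a
    · obtain ⟨rfl, ha'⟩ := hn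
      exact hasTwoTrails_seven ha' hab (by omega)
    refine hasTwoTrails_add_two (k := 2 * n + 5) (by omega) ih ha ?_ ?_
      (Or.inr ⟨⟨n + 2, by ring⟩, by linarith⟩)
    · nlinarith
    · by_contra hc
      rcases Nat.eq_zero_or_pos n with rfl | hpos
      · omega
      · nlinarith

theorem hasTwoTrails_even (n : ℕ) {a b : ℕ} (ha : 3 ≤ a) (hb : 3 ≤ b)
    (h : 1 + a + b ≤ 2 * (n + 3) * (n + 3)) : HasTwoTrails (2 * n + 6) a b := by
  induction n generalizing a b with
  | zero =>
    rcases le_total a b with hab | hab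
    · exact hasTwoTrails_six ha hab (by omega)
    · exact (hasTwoTrails_six hb hab (by omega)).symm
  | succ n ih =>
    wlog hab : a ≤ b generalizing a b
    · exact (this hb ha (by omega) (by omega)).symm
    by_cases h' : 1 + a + b ≤ 2 * (n + 3) * (n + 3)
    · exact (ih ha hb h').mono (by omega)
    -- Likewise with 18 usable edges for six colours.
    by_cases hn : n = 0 ∧ 15 ≤ a
    · obtain ⟨rfl, ha'⟩ := hn
      exact hasTwoTrails_eight ha' hab (by omega)
    refine hasTwoTrails_add_two (k := 2 * n + 6) (by omega) ih ha ?_ ?_ (Or.inl (by linarith))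
    · nlinarith
    · by_contra hc
      rcases Nat.eq_zero_or_pos n with rfl | hpos
      · omega
      · nlinarith

theorem hasTwoTrails {k a b : ℕ} (hk : 5 ≤ k) (ha : 3 ≤ a) (hb : 3 ≤ b)
    (h : 2 * (1 + a + b) ≤ k * (k + 1)) (h' : Even k → 2 * (1 + a + b) ≤ k * k) :
    HasTwoTrails k a b := by
  rcases Nat.even_or_odd' k with ⟨n, rfl | rfl⟩
  · obtain ⟨n, rfl⟩ := Nat.exists_eq_add_of_le (show 3 ≤ n by omega)
    have := hasTwoTrails_even n ha hb (by linarith [h' (even_two_mul _)])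
    rwa [show 2 * (3 + n) = 2 * n + 6 by ring]
  · obtain ⟨n, rfl⟩ := Nat.exists_eq_add_of_le (show 2 ≤ n by omega)
    have := hasTwoTrails_odd n ha hb (by linarith)
    rwa [show 2 * (2 + n) + 1 = 2 * n + 5 by ring]

/-! ### The ceilings as integer inequalities -/

theorem ceil_quadratic_le_iff (e k : ℕ) :
    ⌈(-1 + √(8 * (e : ℝ) + 1)) / 2⌉₊ ≤ k ↔ 2 * e ≤ k * (k + 1) := by
  rw [Nat.ceil_le, div_le_iff₀ two_pos, neg_add_le_iff_le_add, Real.sqrt_le_left (by positivity),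
    ← Nat.cast_le (α := ℝ)]
  push_cast
  constructor <;> intro h <;> linarith

theorem ceil_sqrt_two_mul_le_iff (e k : ℕ) : ⌈√(2 * (e : ℝ))⌉₊ ≤ k ↔ 2 * e ≤ k * k := by
  rw [Nat.ceil_le, Real.sqrt_le_left (by positivity), ← Nat.cast_le (α := ℝ)]
  push_cast
  rw [sq]

/-! ### Lower bounds on the number of colours -/

theorem two_mul_card_le_of_injOn_sym2 {β : Type*} {k : ℕ} (E : Finset β) (p q : β → Fin k)
    (hinj : Set.InjOn (fun e => s(p e, q e)) E) : 2 * E.card ≤ k * (k + 1) := by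
  have h := Finset.card_le_card_of_injOn (t := Finset.univ) _ (fun _ _ => Finset.mem_univ _) hinj
  rw [Finset.card_univ, Sym2.card, Fintype.card_fin, Nat.choose_two_right] at h
  have := Nat.div_mul_le_self ((k + 1) * (k + 1 - 1)) 2
  rw [Nat.add_sub_cancel] at this h
  nlinarith

/-- At each `v` the number of non-loop labels is even and at most the odd number `k - 1`, hence at
most `k - 2`. Summing over `v` counts each non-loop twice, and there are at most `k` loops. -/
theorem two_mul_card_le_of_even {β : Type*} {k : ℕ} (E : Finset β) (p q : β → Fin k)
    (hinj : Set.InjOn (fun e => s(p e, q e)) E)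
    (heven : ∀ v, Even {e ∈ E | Xor (p e = v) (q e = v)}.card) (hk : Even k) :
    2 * E.card ≤ k * k := by
  classical
  have hdeg : ∀ v, {e ∈ E | Xor (p e = v) (q e = v)}.card ≤ k - 2 := by
    intro v
    have h1 : {e ∈ E | Xor (p e = v) (q e = v)}.card ≤ (Finset.univ.erase v).card := by
      -- A non-loop edge at `v` is determined by its other end.
      refine Finset.card_le_card_of_injOn (fun e => if p e = v then q e else p e) ?_ ?_
      · intro e he
        rw [Finset.mem_coe, Finset.mem_filter] at he
        unfold Xor at he
        simp only [Finset.coe_erase, Finset.coe_univ, Set.mem_sdiff, Set.mem_univ, true_and,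
          Set.mem_singleton_iff]
        split_ifs <;> tauto
      · intro e he f hf hef
        rw [Finset.mem_coe, Finset.mem_filter] at he hf
        unfold Xor at he hf
        refine hinj he.1 hf.1 (Sym2.eq_iff.mpr ?_)
        dsimp only at hef
        split_ifs at hef <;> grind
    rw [Finset.card_erase_of_mem (Finset.mem_univ v), Finset.card_univ, Fintype.card_fin] at h1
    have h2 := Nat.even_iff.mp (heven v)
    have h3 := Nat.even_iff.mp hk
    have := v.pos
    omega
  have hloop : {e ∈ E | p e = q e}.card ≤ k := by
    refine (?_ : _ ≤ (Finset.univ : Finset (Fin k)).card).trans_eq (Finset.card_fin k)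
    refine Finset.card_le_card_of_injOn p (fun _ _ => Finset.mem_univ _) ?_
    intro e he f hf hef
    simp only [Finset.mem_coe, Finset.mem_filter] at he hf
    exact hinj he.1 hf.1 (by simp only [← he.2, ← hf.2, hef])
  have hcount : ∑ v, {e ∈ E | Xor (p e = v) (q e = v)}.card = 2 * {e ∈ E | ¬p e = q e}.card := by
    simp only [Finset.card_filter]
    rw [Finset.sum_comm, Finset.mul_sum]
    refine Finset.sum_congr rfl fun e _ => ?_
    split_ifs with h
    · simp only [h, Xor]; simp
    · rw [← Finset.card_filter, mul_one, ← Finset.card_pair h]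
      congr 1
      ext v
      simp only [Finset.mem_filter, Finset.mem_univ, true_and, Finset.mem_insert,
        Finset.mem_singleton]
      unfold Xor
      grind
  have hsum := Finset.sum_le_sum fun v (_ : v ∈ Finset.univ) => hdeg v
  rw [hcount, Finset.sum_const, Finset.card_univ, Fintype.card_fin, smul_eq_mul] at hsum
  have hE := Finset.card_filter_add_card_filter_not (s := E) (fun e => p e = q e)
  rcases Nat.lt_or_ge k 2 with h | h
  · obtain rfl : k = 0 := by
      have := Nat.even_iff.mp hk
      omega
    omega
  · obtain ⟨n, rfl⟩ := Nat.exists_eq_add_of_le h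
    rw [Nat.add_sub_cancel_left] at hsum
    nlinarith

/-- The edges counted are those where the walk enters or leaves the colour class of `v`. For a
closed walk their number is therefore even. -/
theorem even_card_filter_xor_walk {κ : Type*} [DecidableEq κ] (f : ℕ → κ) (v : κ) (n : ℕ) :
    Even {j ∈ Finset.range n | Xor (f j = v) (f (j + 1) = v)}.card ↔ (f 0 = v ↔ f n = v) := by
  induction n with
  | zero => simp
  | succ n ih =>
    rw [Finset.range_add_one, Finset.filter_insert]
    split_ifs with h
    · rw [Finset.card_insert_of_notMem (by simp), Nat.even_add_one, ih]
      unfold Xor at h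
      tauto
    · rw [ih]
      unfold Xor at h
      tauto

/-- The edges of the petal graph, grouped by petals. -/
def petalEdges {m : ℕ} (c : Fin m → ℕ) : Finset (Σ _ : Fin m, ℕ) :=
  Finset.univ.sigma fun i => Finset.range (c i)

section Petal

variable {m k : ℕ} {c : Fin m → ℕ} {φ : Option (Fin m × ℕ) → Fin k}

theorem injOn_petalEdges (h : IsEdgeDistinguishing (petalGraph c) φ) :
    Set.InjOn (fun e : Σ _ : Fin m, ℕ =>
      s(φ (petalVertex c e.1 e.2), φ (petalVertex c e.1 (e.2 + 1)))) (petalEdges c) := by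
  rintro ⟨i, j⟩ he ⟨i', j'⟩ hf hef
  simp only [petalEdges, Finset.coe_sigma, Set.mem_sigma_iff, Finset.coe_univ, Set.mem_univ,
    Finset.coe_range, Set.mem_Iio, true_and] at he hf
  have := @h (i, j) (i', j') _ _ _ _ ⟨he, rfl⟩ ⟨hf, rfl⟩ hef
  simp only [Prod.mk.injEq] at this
  rw [this.1, this.2]

theorem card_petalEdges (c : Fin m → ℕ) : (petalEdges c).card = ∑ i, c i := by
  simp [petalEdges]

theorem even_card_filter_petalEdges (φ : Option (Fin m × ℕ) → Fin k) (v : Fin k) :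
    Even {e ∈ petalEdges c | Xor (φ (petalVertex c e.1 e.2) = v)
      (φ (petalVertex c e.1 (e.2 + 1)) = v)}.card := by
  rw [Finset.card_filter, petalEdges, Finset.sum_sigma]
  refine Finset.even_sum _ fun i _ => ?_
  rw [← Finset.card_filter]
  exact (even_card_filter_xor_walk (fun j => φ (petalVertex c i j)) v (c i)).mpr
    (by simp [petalVertex])

theorem IsEdgeDistinguishing.two_mul_sum_le (h : IsEdgeDistinguishing (petalGraph c) φ) :
    2 * ∑ i, c i ≤ k * (k + 1) := by
  rw [← card_petalEdges]
  exact two_mul_card_le_of_injOn_sym2 _ _ _ (injOn_petalEdges h)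

theorem IsEdgeDistinguishing.two_mul_sum_le_of_even (h : IsEdgeDistinguishing (petalGraph c) φ)
    (hk : Even k) : 2 * ∑ i, c i ≤ k * k := by
  rw [← card_petalEdges]
  exact two_mul_card_le_of_even _ _ _ (injOn_petalEdges h) (even_card_filter_petalEdges φ) hk

end Petal

theorem IsEdgeDistinguishing.five_le {k a b : ℕ} {φ : Option (Fin 3 × ℕ) → Fin k}
    (h : IsEdgeDistinguishing (petalGraph ![1, a, b]) φ) (ha : 3 ≤ a) (hb : 3 ≤ b) : 5 ≤ k := by
  -- The other ends of the five edges at `u₀`; the loop contributes `u₀` itself. Equal colours here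
  -- would give equal labels.
  let w : Fin 5 → Option (Fin 3 × ℕ) :=
    ![none, some (1, 1), some (1, a - 1), some (2, 1), some (2, b - 1)]
  let ε : Fin 5 → Fin 3 × ℕ := ![(0, 0), (1, 0), (1, a - 1), (2, 0), (2, b - 1)]
  have hlink : ∀ i, (petalGraph ![1, a, b]).IsLink (ε i) none (w i) := by
    have h1 : a - 1 + 1 = a := by omega
    have h2 : b - 1 + 1 = b := by omega
    have h3 : ¬(a - 1 = 0 ∨ a - 1 = a) := by omega
    have h4 : ¬(b - 1 = 0 ∨ b - 1 = b) := by omega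
    have h5 : ¬(1 = a) := by omega
    have h6 : ¬(1 = b) := by omega
    have hG : ∀ e x y, (petalGraph ![1, a, b]).IsLink e x y ↔ e.2 < ![1, a, b] e.1 ∧
        s(x, y) = s(petalVertex ![1, a, b] e.1 e.2, petalVertex ![1, a, b] e.1 (e.2 + 1)) :=
      fun _ _ _ => Iff.rfl
    intro i
    rw [hG]
    fin_cases i <;> simp [petalVertex, w, ε, h1, h2, h3, h4, h5, h6] <;> omega
  have hε : Function.Injective ε := by
    intro i j
    fin_cases i <;> fin_cases j <;> simp [ε] <;> omega
  have hinj : Function.Injective (φ ∘ w) := by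
    intro i j hij
    refine hε (h (hlink i) (hlink j) ?_)
    rw [show φ (w i) = φ (w j) from hij]
  simpa using Fintype.card_le_of_injective _ hinj

/-! ### From trails to colourings, and the theorem -/

theorem HasTwoTrails.exists_isEdgeDistinguishing {k a b : ℕ} (h : HasTwoTrails k a b)
    (hk : 0 < k) : ∃ φ : Option (Fin 3 × ℕ) → Fin k,
      IsEdgeDistinguishing (petalGraph ![1, a, b]) φ := by
  obtain ⟨l, m, rfl, rfl, hlk, hmk, hnd⟩ := h
  -- The empty list encodes the loop, since `closingEdges 0 []` is `[s(0, 0)]`; all three petals are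
  -- then treated alike.
  let t : Fin 3 → List ℕ := ![[], l, m]
  have ht : ∀ i v, v ∈ t i → v < k := by
    intro i v
    fin_cases i
    · simp [t]
    · exact hlk v
    · exact hmk v
  have hlen : ∀ i, ![1, l.length + 1, m.length + 1] i = (closingEdges 0 (t i)).length := by
    intro i
    fin_cases i <;> simp [t, length_closingEdges]
  have hget : ∀ i j, (0 :: t i).getD j 0 < k := by
    intro i j
    rw [List.getD_eq_getElem?_getD]
    rcases hx : (0 :: t i)[j]? with _ | x
    · exact hk
    · rcases List.mem_cons.mp (List.mem_of_getElem? hx) with rfl | hx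
      · exact hk
      · exact ht i x hx
  let φ : Option (Fin 3 × ℕ) → Fin k := fun o =>
    o.elim ⟨0, hk⟩ fun x => ⟨(0 :: t x.1).getD x.2 0, hget _ _⟩
  have hφ : ∀ i j, (φ (petalVertex ![1, l.length + 1, m.length + 1] i j)).val =
      (0 :: t i).getD j 0 := by
    intro i j
    unfold petalVertex
    split_ifs with hj
    · rcases hj with rfl | rfl
      · rfl
      · rw [hlen, length_closingEdges, List.getD_eq_default _ _ (by simp)]
        rfl
    · rfl
  have hflat : (List.ofFn fun i => closingEdges 0 (t i)).flatten.Nodup := by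
    simpa [t, List.ofFn_succ, closingEdges] using hnd
  rw [List.nodup_flatten, List.pairwise_ofFn] at hflat
  have hdisj : ∀ i j, i ≠ j → List.Disjoint (closingEdges 0 (t i)) (closingEdges 0 (t j)) := by
    intro i j hij
    rcases lt_or_gt_of_ne hij with hlt | hlt
    · exact hflat.2 hlt
    · exact (hflat.2 hlt).symm
  have hlabel : ∀ {e : Fin 3 × ℕ} {u v}, (petalGraph ![1, l.length + 1, m.length + 1]).IsLink e u v →
      ∃ hj : e.2 < (closingEdges 0 (t e.1)).length,
        s((φ u).val, (φ v).val) = (closingEdges 0 (t e.1))[e.2] := by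
    rintro ⟨i, j⟩ u v ⟨hj, hs⟩
    rw [hlen] at hj
    refine ⟨hj, ?_⟩
    rw [getElem_closingEdges, ← hφ, ← hφ]
    exact congrArg (Sym2.map fun u => (φ u).val) hs
  refine ⟨φ, ?_⟩
  rintro ⟨i, j⟩ ⟨i', j'⟩ u v x y h1 h2 heq
  obtain ⟨hj, h1⟩ := hlabel h1
  obtain ⟨hj', h2⟩ := hlabel h2
  have heq' : s((φ u).val, (φ v).val) = s((φ x).val, (φ y).val) := congrArg (Sym2.map Fin.val) heq
  rw [h1, h2] at heq'
  dsimp only at heq'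
  obtain rfl : i = i' := by
    by_contra hne
    exact hdisj i i' hne (List.getElem_mem hj) (heq' ▸ List.getElem_mem hj')
  have hnd' : (closingEdges 0 (t i)).Nodup := hflat.1 _ (List.mem_ofFn.mpr ⟨i, rfl⟩)
  rw [(hnd'.getElem_inj_iff).mp heq']

theorem exists_isEdgeDistinguishing_petalGraph_iff {k a b : ℕ} (ha : 3 ≤ a) (hb : 3 ≤ b) :
    (0 < k ∧ ∃ φ : Option (Fin 3 × ℕ) → Fin k, IsEdgeDistinguishing (petalGraph ![1, a, b]) φ) ↔
      5 ≤ k ∧ 2 * (1 + a + b) ≤ k * (k + 1) ∧ (Even k → 2 * (1 + a + b) ≤ k * k) := by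
  constructor
  · rintro ⟨-, φ, h⟩
    have hsum : ∑ i, ![1, a, b] i = 1 + a + b := by simp [Fin.sum_univ_three]
    exact ⟨h.five_le ha hb, hsum ▸ h.two_mul_sum_le, fun hk => hsum ▸ h.two_mul_sum_le_of_even hk⟩
  · rintro ⟨hk, h, h'⟩
    exact ⟨by omega, (hasTwoTrails hk ha hb h h').exists_isEdgeDistinguishing (by omega)⟩

theorem mainTheorem3 (c₂ c₃ e : ℕ) (h₂ : 3 ≤ c₂) (h₂₃ : c₂ ≤ c₃) (he : e = 1 + c₂ + c₃) :
    (e ≤ 10 → edcn (petalGraph ![1, c₂, c₃]) = 5) ∧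
    (11 ≤ e → Odd ⌈(-1 + √(8 * (e : ℝ) + 1)) / 2⌉₊ →
      edcn (petalGraph ![1, c₂, c₃]) = ⌈(-1 + √(8 * (e : ℝ) + 1)) / 2⌉₊) ∧
    (11 ≤ e → ¬ Odd ⌈(-1 + √(8 * (e : ℝ) + 1)) / 2⌉₊ →
      edcn (petalGraph ![1, c₂, c₃]) = ⌈√(2 * (e : ℝ))⌉₊) := by
  have hmin : ∀ n, (5 ≤ n ∧ 2 * e ≤ n * (n + 1) ∧ (Even n → 2 * e ≤ n * n)) →
      (∀ k, 5 ≤ k → 2 * e ≤ k * (k + 1) → (Even k → 2 * e ≤ k * k) → n ≤ k) →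
      edcn (petalGraph ![1, c₂, c₃]) = n := by
    intro n hn hle
    have hset := fun k =>
      exists_isEdgeDistinguishing_petalGraph_iff (k := k) h₂ (h₂.trans h₂₃)
    rw [← he] at hset
    refine IsLeast.csInf_eq ⟨(hset n).mpr hn, fun k hk => ?_⟩
    obtain ⟨h1, h2, h3⟩ := (hset k).mp hk
    exact hle k h1 h2 h3
  have hq := ceil_quadratic_le_iff e
  have hr := ceil_sqrt_two_mul_le_iff e
  generalize ⌈(-1 + √(8 * (e : ℝ) + 1)) / 2⌉₊ = q at hq ⊢
  generalize ⌈√(2 * (e : ℝ))⌉₊ = r at hr ⊢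
  have hq0 := (hq q).mp le_rfl
  have hr0 := (hr r).mp le_rfl
  refine ⟨fun h10 => ?_, fun h11 hodd => ?_, fun h11 hodd => ?_⟩
  · exact hmin 5 ⟨le_rfl, by omega, fun h => absurd h (by decide)⟩ fun k hk _ _ => hk
  · have hq5 : 5 ≤ q := by
      by_contra hlt
      nlinarith [show q ≤ 4 by omega]
    exact hmin q ⟨hq5, hq0, fun h => absurd hodd (Nat.not_odd_iff_even.mpr h)⟩
      fun k _ hk _ => (hq k).mpr hk
  · have hr5 : 5 ≤ r := by
      by_contra hlt
      nlinarith [show r ≤ 4 by omega]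
    refine hmin r ⟨hr5, by nlinarith, fun _ => hr0⟩ fun k _ hk hk' => (hr k).mpr ?_
    by_cases hev : Even k
    · exact hk' hev
    -- For odd `k`, parity makes `q ≤ k` strict, whence `2e ≤ q(q+1) ≤ k²`.
    · have hle := (hq k).mpr hk
      have hne : q ≠ k := fun h => hev (h ▸ Nat.not_odd_iff_even.mp hodd)
      nlinarith [show q + 1 ≤ k by omega]
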